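/- Let $q\in\mathbb C\setminus\{0\}$ be arbitrary, and let $A_1,\dots,A_k$ be $2\times 2$ matrices with coefficients in an associative unital algebra $\mathcal A$ over $\mathbb C$ such that: 1. each $A_i$ is triangular, of the form $\begin{pmatrix} a_i & b_i\\ 0 & a_i^{-1}\end{pmatrix}$ or $\begin{pmatrix} a_i & 0\\ b_i & a_i^{-1}\end{pmatrix}$, with $a_i\in\mathcal A$ invertible, $b_i\in\mathcal A$ and $b_ia_i=q\,a_ib_i$; 2. $a_i$ and $b_i$ commute with $a_j$ and $b_j$ whenever $i\neq j$. Let $S_n(t),T_n(t)\in\mathbb Z[t]$ be the normalized Chebyshev polynomials, defined by $S_0=1$, $S_1=t$, $S_{n+1}=t\,S_n-S_{n-1}$ and $T_0=2$, $T_1=t$, $T_{n+1}=t\,T_n-T_{n-1}$. Then, for every integer $n\geq 0$, each of the two elements $$S_n\big(\mathrm{Trace}\,A_1A_2\cdots A_k\big)\quad\text{and}\quad T_n\big(\mathrm{Trace}\,A_1A_2\cdots A_k\big)$$ of $\mathcal A$ can be written as a finite sum of monomials of the form $+\,q^{\xi}\prod_{i=1}^k a_i^{\alpha_i}b_i^{\beta_i}$,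 all with coefficient $+1$, with integer exponents $\xi,\alpha_i\in\mathbb Z$ and $\beta_i\in\mathbb Z_{\geq 0}$. -/

import Mathlib

/-- The monomial `q ^ ξ * ∏ i, (a i) ^ (α i) * (b i) ^ (β i)` of a `ℂ`-algebra, the factors being
multiplied in the order `i = 0, 1, …, k - 1`. The `a i` are units, so that negative exponents make
sense for them; the `b i` only have exponents in `ℕ`. -/
noncomputable def qMonomial {𝒜 : Type*} [Ring 𝒜] [Algebra ℂ 𝒜] {k : ℕ} (q : ℂ)
    (a : Fin k → 𝒜ˣ) (b : Fin k → 𝒜) (ξ : ℤ) (α : Fin k → ℤ) (β : Fin k → ℕ) : 𝒜 :=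
  (q ^ ξ) • (List.ofFn fun i => ((a i ^ α i : 𝒜ˣ) : 𝒜) * b i ^ β i).prod

/-- `x` is a finite sum of monomials `q ^ ξ * ∏ i, (a i) ^ (α i) * (b i) ^ (β i)`, each with
coefficient `+1` (repetitions are allowed). -/
def IsSumOfPositiveMonomials {𝒜 : Type*} [Ring 𝒜] [Algebra ℂ 𝒜] {k : ℕ} (q : ℂ)
    (a : Fin k → 𝒜ˣ) (b : Fin k → 𝒜) (x : 𝒜) : Prop :=
  ∃ (N : ℕ) (ξ : Fin N → ℤ) (α : Fin N → Fin k → ℤ) (β : Fin N → Fin k → ℕ),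
    x = ∑ j, qMonomial q a b (ξ j) (α j) (β j)

/-! On the quantum plane `y x = q x y`, with coordinates commuting with `𝒜`, a triangular `A` with
`b a = q a b` acts by sending `x` and `y` to the linear forms given by its rows: these again satisfy
the relation, and the quantum determinant is 1. Let `R m` be the `m × m` matrix of this action in
degree `m - 1`. Multiplication from (degree `m`) ⊗ (degree 1) to degree `m + 1`, and the inclusion
of its kernel, a copy of degree `m - 1`, are scalar matrices that intertwine the actions. Hence `tr
R (m+1) * tr A = tr R m + tr R (m+2)` (`trace_eq_add_of_intertwine`), the Chebyshev recursion.
Distinct factors commute, so the intertwining passes to products, and `S_n` of the trace is the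
trace of the product of the `R i (n+1)` (`aeval_trace_chebyshev_S`). By the `q`-binomial theorem the
entries are Gaussian binomials in `q ^ 2` times powers of `q` and monomials, hence positive.

For `T_n = S_n - S_{n-2}`, delete the first and last rows and columns of `R (m+2)`. By Pascal's rule
the rest dominates, entry by entry, a diagonal conjugate of `R m`. Domination survives products
(`list_prod_sub_mem`), and the conjugation does not change the trace.

Positivity is expressed as membership in a subsemiring containing the `a i`, their inverses, the `b
i` and all powers of `q`. -/

/-- The Gaussian binomial coefficient `[n choose k]_p`, defined by Pascal's rule. -/
def gaussBinom {R : Type*} [Semiring R] (p : R) : ℕ → ℕ → R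
  | _, 0 => 1
  | 0, _ + 1 => 0
  | n + 1, k + 1 => gaussBinom p n k + p ^ (k + 1) * gaussBinom p n (k + 1)

/-! ### Gaussian binomials and their positivity. -/

section gaussBinom

variable {R : Type*} [Semiring R] (p : R)

@[simp] lemma gaussBinom_zero_right (n : ℕ) : gaussBinom p n 0 = 1 := by
  cases n <;> rfl

lemma gaussBinom_succ_succ (n k : ℕ) :
    gaussBinom p (n + 1) (k + 1) = gaussBinom p n k + p ^ (k + 1) * gaussBinom p n (k + 1) := rfl

lemma gaussBinom_eq_zero_of_lt {n k : ℕ} (h : n < k) : gaussBinom p n k = 0 := by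
  induction n generalizing k with
  | zero => obtain ⟨k, rfl⟩ := Nat.exists_eq_succ_of_ne_zero h.ne'; rfl
  | succ n ih =>
    obtain ⟨k, rfl⟩ := Nat.exists_eq_succ_of_ne_zero (by omega : k ≠ 0)
    rw [gaussBinom_succ_succ, ih (by omega), ih (by omega), mul_zero, add_zero]

@[simp] lemma gaussBinom_self (n : ℕ) : gaussBinom p n n = 1 := by
  induction n with
  | zero => rfl
  | succ n ih => rw [gaussBinom_succ_succ, ih, gaussBinom_eq_zero_of_lt p (by omega)]; simp

lemma gaussBinom_mem (S : Subsemiring R) (hp : p ∈ S) (n k : ℕ) : gaussBinom p n k ∈ S := by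
  induction n generalizing k with
  | zero => cases k with
    | zero => exact S.one_mem
    | succ k => exact S.zero_mem
  | succ n ih => cases k with
    | zero => exact S.one_mem
    | succ k => exact S.add_mem (ih k) (S.mul_mem (pow_mem hp _) (ih _))

end gaussBinom

/-! ### Normal ordering for a `q`-commuting pair. -/

section orderedMonomial

variable {𝒜 : Type*} [Ring 𝒜]

/-- The monomial `a ^ z * b ^ k`. -/
def orderedMonomial (a : 𝒜ˣ) (b : 𝒜) (z : ℤ) (k : ℕ) : 𝒜 := ((a ^ z : 𝒜ˣ) : 𝒜) * b ^ k

lemma orderedMonomial_mul_right (a : 𝒜ˣ) (b : 𝒜) (z : ℤ) (k : ℕ) :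
    orderedMonomial a b z k * b = orderedMonomial a b z (k + 1) := by
  simp [orderedMonomial, mul_assoc, pow_succ]

lemma orderedMonomial_mem {a : 𝒜ˣ} {b : 𝒜} (S : Subsemiring 𝒜) (ha : (a : 𝒜) ∈ S)
    (ha' : ((a⁻¹ : 𝒜ˣ) : 𝒜) ∈ S) (hb : b ∈ S) (z : ℤ) (k : ℕ) :
    orderedMonomial a b z k ∈ S := by
  refine S.mul_mem ?_ (pow_mem hb k)
  obtain ⟨n, rfl | rfl⟩ := z.eq_nat_or_neg
  · simpa using pow_mem ha n
  · simpa [← inv_pow] using pow_mem ha' n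

lemma Commute.orderedMonomial_left {a : 𝒜ˣ} {b x : 𝒜} (ha : Commute (a : 𝒜) x)
    (hb : Commute b x) (z : ℤ) (k : ℕ) : Commute (orderedMonomial a b z k) x :=
  (ha.units_zpow_left z).mul_left (hb.pow_left k)

variable [Algebra ℂ 𝒜]

lemma mul_zpow_of_mul_eq_smul {q : ℂ} (hq : q ≠ 0) {a : 𝒜ˣ} {b : 𝒜}
    (h : b * (a : 𝒜) = q • ((a : 𝒜) * b)) (z : ℤ) :
    b * ((a ^ z : 𝒜ˣ) : 𝒜) = q ^ z • (((a ^ z : 𝒜ˣ) : 𝒜) * b) := by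
  -- With `q` turned into a central unit `u`, the relation says that `b` semiconjugates `a` to `u *
  -- a`, which passes to integer powers.
  let u : 𝒜ˣ := Units.map (algebraMap ℂ 𝒜).toMonoidHom (Units.mk0 q hq)
  have hu : ∀ n : ℤ, ((u ^ n : 𝒜ˣ) : 𝒜) = algebraMap ℂ 𝒜 (q ^ n) := fun n => by
    rw [← map_zpow, Units.coe_map, Units.val_zpow_eq_zpow_val]; rfl
  have hc : Commute u a := Units.ext (Algebra.commutes q (a : 𝒜))
  have hs : SemiconjBy b (a : 𝒜) ((u * a : 𝒜ˣ) : 𝒜) := by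
    have h1 := hu 1
    rw [zpow_one, zpow_one] at h1
    rw [SemiconjBy, h, Units.val_mul, h1, Algebra.smul_def, mul_assoc]
  have := SemiconjBy.units_zpow_right hs z
  rw [SemiconjBy, hc.mul_zpow, Units.val_mul, hu] at this
  rw [this, Algebra.smul_def, mul_assoc]

lemma pow_mul_zpow_of_mul_eq_smul {q : ℂ} (hq : q ≠ 0) {a : 𝒜ˣ} {b : 𝒜}
    (h : b * (a : 𝒜) = q • ((a : 𝒜) * b)) (k : ℕ) (z : ℤ) :
    b ^ k * ((a ^ z : 𝒜ˣ) : 𝒜) = q ^ (k * z) • (((a ^ z : 𝒜ˣ) : 𝒜) * b ^ k) := by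
  induction k with
  | zero => simp
  | succ k ih =>
    rw [pow_succ', mul_assoc, ih, mul_smul_comm, ← mul_assoc, mul_zpow_of_mul_eq_smul hq h,
      smul_mul_assoc, smul_smul, mul_assoc, ← zpow_add₀ hq]
    congr 2
    push_cast; ring

lemma orderedMonomial_mul {q : ℂ} (hq : q ≠ 0) {a : 𝒜ˣ} {b : 𝒜}
    (h : b * (a : 𝒜) = q • ((a : 𝒜) * b)) (z w : ℤ) (k l : ℕ) :
    orderedMonomial a b z k * orderedMonomial a b w l =
      q ^ (k * w) • orderedMonomial a b (z + w) (k + l) := by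
  simp only [orderedMonomial]
  rw [mul_assoc, ← mul_assoc (b ^ k), pow_mul_zpow_of_mul_eq_smul hq h, zpow_add, Units.val_mul,
    pow_add]
  simp only [smul_mul_assoc, mul_smul_comm, mul_assoc]

lemma orderedMonomial_mul_val {q : ℂ} (hq : q ≠ 0) {a : 𝒜ˣ} {b : 𝒜}
    (h : b * (a : 𝒜) = q • ((a : 𝒜) * b)) (z : ℤ) (k : ℕ) :
    orderedMonomial a b z k * a = q ^ k • orderedMonomial a b (z + 1) k := by
  simpa [orderedMonomial] using orderedMonomial_mul hq h z 1 k 0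

lemma orderedMonomial_mul_inv {q : ℂ} (hq : q ≠ 0) {a : 𝒜ˣ} {b : 𝒜}
    (h : b * (a : 𝒜) = q • ((a : 𝒜) * b)) (z : ℤ) (k : ℕ) :
    orderedMonomial a b z k * ((a⁻¹ : 𝒜ˣ) : 𝒜) =
      (q ^ k)⁻¹ • orderedMonomial a b (z - 1) k := by
  simpa [orderedMonomial, sub_eq_add_neg] using orderedMonomial_mul hq h z (-1) k 0

end orderedMonomial

/-! ### Multiplication on the quantum plane and the trace identity. -/

section symPower

open Matrix
open scoped Kronecker

/-- The matrix of scalars whose rows span the kernel of the multiplication map from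
`(degree m) ⊗ (degree 1)` to `degree m + 1` on the quantum plane. -/
noncomputable def quantumKer (𝒜 : Type*) [Ring 𝒜] [Algebra ℂ 𝒜] (q : ℂ) (m : ℕ) :
    Matrix (Fin m) (Fin (m + 1) × Fin 2) 𝒜 :=
  of fun i p => if p.2 = 0 then (if p.1 = i.succ then 1 else 0)
    else (if p.1 = i.castSucc then -algebraMap ℂ 𝒜 (q ^ ((i : ℕ) + 1)) else 0)

/-- The matrix of the multiplication map from `(degree m) ⊗ (degree 1)` to `degree m + 1` on the
quantum plane. -/
noncomputable def quantumMul (𝒜 : Type*) [Ring 𝒜] [Algebra ℂ 𝒜] (q : ℂ) (m : ℕ) :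
    Matrix (Fin (m + 1) × Fin 2) (Fin (m + 2)) 𝒜 :=
  of fun p j => if p.2 = 0 then (if j = p.1.castSucc then algebraMap ℂ 𝒜 (q ^ (p.1 : ℕ)) else 0)
    else (if j = p.1.succ then 1 else 0)

variable {𝒜 : Type*} [Ring 𝒜] [Algebra ℂ 𝒜] (q : ℂ) (m : ℕ)

section entries

variable {ι : Type*}

lemma quantumKer_mul_apply (W : Matrix (Fin (m + 1) × Fin 2) ι 𝒜) (i : Fin m) (p : ι) :
    (quantumKer 𝒜 q m * W) i p =
      W (i.succ, 0) p - q ^ ((i : ℕ) + 1) • W (i.castSucc, 1) p := by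
  simp [quantumKer, mul_apply, Fintype.sum_prod_type, Finset.sum_add_distrib, Algebra.smul_def,
    sub_eq_add_neg]

lemma mul_quantumKer_apply_succ (R : Matrix ι (Fin m) 𝒜) (i : ι) (j : Fin m) :
    (R * quantumKer 𝒜 q m) i (j.succ, 0) = R i j := by
  simp [quantumKer, mul_apply]

lemma mul_quantumKer_apply_zero (R : Matrix ι (Fin m) 𝒜) (i : ι) :
    (R * quantumKer 𝒜 q m) i (0, 0) = 0 := by
  simp [quantumKer, mul_apply, (Fin.succ_ne_zero _).symm]

lemma mul_quantumKer_apply_castSucc (R : Matrix ι (Fin m) 𝒜) (i : ι) (j : Fin m) :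
    (R * quantumKer 𝒜 q m) i (j.castSucc, 1) = -(q ^ ((j : ℕ) + 1) • R i j) := by
  simp [quantumKer, mul_apply, Algebra.smul_def, Algebra.commutes, -map_pow]

lemma mul_quantumKer_apply_last (R : Matrix ι (Fin m) 𝒜) (i : ι) :
    (R * quantumKer 𝒜 q m) i (Fin.last m, 1) = 0 := by
  simp [quantumKer, mul_apply, (Fin.castSucc_ne_last _).symm]

lemma quantumMul_mul_apply_zero (R : Matrix (Fin (m + 2)) ι 𝒜) (i : Fin (m + 1)) (j : ι) :
    (quantumMul 𝒜 q m * R) (i, 0) j = q ^ (i : ℕ) • R i.castSucc j := by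
  simp [quantumMul, mul_apply, Algebra.smul_def]

lemma quantumMul_mul_apply_one (R : Matrix (Fin (m + 2)) ι 𝒜) (i : Fin (m + 1)) (j : ι) :
    (quantumMul 𝒜 q m * R) (i, 1) j = R i.succ j := by
  simp [quantumMul, mul_apply]

lemma mul_quantumMul_apply_zero (W : Matrix ι (Fin (m + 1) × Fin 2) 𝒜) (p : ι) :
    (W * quantumMul 𝒜 q m) p 0 = W p (0, 0) := by
  simp [quantumMul, mul_apply, Fintype.sum_prod_type, (Fin.succ_ne_zero _).symm,
    Fin.sum_univ_succ]

lemma mul_quantumMul_apply_castSucc_succ (W : Matrix ι (Fin (m + 1) × Fin 2) 𝒜) (p : ι)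
    (j : Fin m) :
    (W * quantumMul 𝒜 q m) p j.castSucc.succ =
      q ^ ((j : ℕ) + 1) • W p (j.succ, 0) + W p (j.castSucc, 1) := by
  have h : ∀ x : Fin (m + 1), j.castSucc.succ = x.castSucc ↔ x = j.succ := fun x => by
    rw [Fin.succ_castSucc, Fin.castSucc_inj, eq_comm]
  simp [quantumMul, mul_apply, Fintype.sum_prod_type, Finset.sum_add_distrib, h,
    Algebra.smul_def, Algebra.commutes, -map_pow, -Fin.castSucc_succ]

lemma mul_quantumMul_apply_last (W : Matrix ι (Fin (m + 1) × Fin 2) 𝒜) (p : ι) :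
    (W * quantumMul 𝒜 q m) p (Fin.last m).succ = W p (Fin.last m, 1) := by
  have h : ∀ x : Fin (m + 1), (Fin.last m).succ ≠ x.castSucc := fun x => by
    rw [Fin.succ_last]; exact (Fin.castSucc_ne_last x).symm
  simp [quantumMul, mul_apply, Fintype.sum_prod_type, h, -Fin.succ_last]

end entries

variable {q m}

/-- Only diagonal entries of the intertwining relations are compared: the off-diagonal terms `W (i,
1) (i + 1, 0)` enter `R` and `R'` with opposite coefficients `∓q ^ (i + 1)` and cancel. No
commutativity of the entries is needed. -/
lemma trace_eq_add_of_intertwine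
    {W : Matrix (Fin (m + 1) × Fin 2) (Fin (m + 1) × Fin 2) 𝒜}
    {R : Matrix (Fin m) (Fin m) 𝒜} {R' : Matrix (Fin (m + 2)) (Fin (m + 2)) 𝒜}
    (hk : quantumKer 𝒜 q m * W = R * quantumKer 𝒜 q m)
    (hm : W * quantumMul 𝒜 q m = quantumMul 𝒜 q m * R') :
    W.trace = R.trace + R'.trace := by
  have h1 (i : Fin m) := congrFun₂ hk i (i.succ, 0)
  have h2 := congrFun₂ hm (0, 0) 0
  have h3 (i : Fin m) := congrFun₂ hm (i.castSucc, 1) i.castSucc.succ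
  have h4 := congrFun₂ hm (Fin.last m, 1) (Fin.last m).succ
  simp only [quantumKer_mul_apply, mul_quantumKer_apply_succ] at h1
  rw [mul_quantumMul_apply_zero, quantumMul_mul_apply_zero] at h2
  simp only [mul_quantumMul_apply_castSucc_succ, quantumMul_mul_apply_one] at h3
  rw [mul_quantumMul_apply_last, quantumMul_mul_apply_one] at h4
  simp only [trace, diag_apply, Fintype.sum_prod_type, Fin.sum_univ_two, Finset.sum_add_distrib]
  rw [Fin.sum_univ_succ, Fin.sum_univ_castSucc, Fin.sum_univ_succ (n := m + 1),
    Fin.sum_univ_castSucc (n := m), h2, h4]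
  simp only [← h1, ← h3, Finset.sum_add_distrib, Finset.sum_sub_distrib]
  simp
  abel

/-- Over a noncommutative ring the mixed-product rule needs just the inner factors `Q` and `P'` to
commute entrywise. -/
lemma kronecker_mul_kronecker_of_commute {𝒜 l n : Type*} [Ring 𝒜] [Fintype l] [Fintype n]
    {P P' : Matrix l l 𝒜} {Q Q' : Matrix n n 𝒜}
    (h : ∀ i j i' j', Commute (Q i j) (P' i' j')) :
    (P ⊗ₖ Q) * (P' ⊗ₖ Q') = (P * P') ⊗ₖ (Q * Q') := by
  ext ⟨i, c⟩ ⟨j, d⟩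
  simp only [mul_apply, kronecker_apply, Fintype.sum_prod_type, Finset.sum_mul, Finset.mul_sum]
  rw [Finset.sum_comm]
  refine Finset.sum_congr rfl fun x _ => Finset.sum_congr rfl fun y _ => ?_
  rw [mul_assoc, ← mul_assoc (Q c _), (h _ _ _ _).eq]
  simp only [mul_assoc]

end symPower

/-! ### Explicit symmetric powers of triangular matrices. -/

section symPower

open Matrix
open scoped Kronecker

variable {𝒜 : Type*} [Ring 𝒜] [Algebra ℂ 𝒜]

/-- The matrices `R m` of the action of the `2 × 2` matrix `A` on the polynomials of degree `m - 1`
in the quantum plane: multiplication of polynomials is equivariant, and so is the inclusion of its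
kernel. The entries are positive combinations of the monomials in `a` and `b`, and, up to a
rescaling of the basis, the matrix `R (m + 2)` dominates `R m`. -/
structure IsSymPowerFamily (q : ℂ) (a : 𝒜ˣ) (b : 𝒜) (A : Matrix (Fin 2) (Fin 2) 𝒜)
    (R : ∀ m : ℕ, Matrix (Fin m) (Fin m) 𝒜) : Prop where
  one : R 1 = 1
  ker_mul (m : ℕ) : quantumKer 𝒜 q m * (R (m + 1) ⊗ₖ A) = R m * quantumKer 𝒜 q m
  mul_mul (m : ℕ) : (R (m + 1) ⊗ₖ A) * quantumMul 𝒜 q m = quantumMul 𝒜 q m * R (m + 2)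
  commute {x : 𝒜} : Commute (a : 𝒜) x → Commute b x → ∀ m i j, Commute (R m i j) x
  entry_commute {x : 𝒜} : Commute (a : 𝒜) x → Commute b x → ∀ c d, Commute (A c d) x
  mem (S : Subsemiring 𝒜) : (a : 𝒜) ∈ S → ((a⁻¹ : 𝒜ˣ) : 𝒜) ∈ S → b ∈ S →
    (∀ z : ℤ, algebraMap ℂ 𝒜 (q ^ z) ∈ S) → ∀ m i j, R m i j ∈ S
  sub_mem (S : Subsemiring 𝒜) : (a : 𝒜) ∈ S → ((a⁻¹ : 𝒜ˣ) : 𝒜) ∈ S → b ∈ S →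
    (∀ z : ℤ, algebraMap ℂ 𝒜 (q ^ z) ∈ S) → ∀ (m : ℕ) (i j : Fin m),
      R (m + 2) i.castSucc.succ j.castSucc.succ - q ^ ((j : ℤ) - i) • R m i j ∈ S

/-- The entries of the action of an upper triangular matrix on the quantum plane. -/
noncomputable def upperEntry (q : ℂ) (a : 𝒜ˣ) (b : 𝒜) (m i j : ℕ) : 𝒜 :=
  if i ≤ j then (gaussBinom (q ^ 2) (m - 1 - i) (j - i) * (q ^ (i * (j - i)))⁻¹) •
    orderedMonomial a b ((m : ℤ) - 1 - i - j) (j - i) else 0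

/-- The entries of the action of a lower triangular matrix on the quantum plane. -/
noncomputable def lowerEntry (q : ℂ) (a : 𝒜ˣ) (b : 𝒜) (m i j : ℕ) : 𝒜 :=
  if j ≤ i then (gaussBinom (q ^ 2) i j * (q ^ (j * (i - j)))⁻¹) •
    orderedMonomial a b ((m : ℤ) - 1 - i - j) (i - j) else 0

variable {q : ℂ} {a : 𝒜ˣ} {b : 𝒜} {m i j : ℕ}

lemma upperEntry_of_lt (h : j < i) : upperEntry q a b m i j = 0 := if_neg (by omega)

/-- Indices are natural numbers, so the column past the last one makes sense and vanishes; the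
boundary cases of the intertwining relations thus follow from the generic ones. -/
lemma upperEntry_of_le (h : m ≤ j) (hi : i < m) : upperEntry q a b m i j = 0 := by
  rw [upperEntry, gaussBinom_eq_zero_of_lt _ (by omega)]; simp

lemma upperEntry_eq {N k : ℕ} {e : ℤ} (hm : m = i + N + 1) (hj : j = i + k)
    (he : e = N - i - k) : upperEntry q a b m i j =
      (gaussBinom (q ^ 2) N k * (q ^ (i * k))⁻¹) • orderedMonomial a b e k := by
  subst hm hj
  rw [upperEntry, if_pos (by omega), he, show i + N + 1 - 1 - i = N by omega,
    Nat.add_sub_cancel_left]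
  congr 2
  push_cast; ring

lemma lowerEntry_of_lt (h : i < j) : lowerEntry q a b m i j = 0 := if_neg (by omega)

lemma lowerEntry_eq {k : ℕ} {e : ℤ} (hi : i = j + k) (he : e = m - 1 - 2 * j - k) :
    lowerEntry q a b m i j =
      (gaussBinom (q ^ 2) i j * (q ^ (j * k))⁻¹) • orderedMonomial a b e k := by
  subst hi
  rw [lowerEntry, if_pos (by omega), he, Nat.add_sub_cancel_left]
  congr 2
  push_cast; ring

lemma upperEntry_mul_val (hq : q ≠ 0) (h : b * (a : 𝒜) = q • ((a : 𝒜) * b))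
    (hi : i < m) :
    upperEntry q a b (m + 1) (i + 1) (j + 1) * a = upperEntry q a b m i j := by
  obtain ⟨N, rfl⟩ := Nat.exists_eq_add_of_lt hi
  obtain hj | hj := lt_or_ge j i
  · rw [upperEntry_of_lt hj, upperEntry_of_lt (by omega), zero_mul]
  obtain ⟨k, rfl⟩ := Nat.exists_eq_add_of_le hj
  rw [upperEntry_eq (N := N) (k := k) (e := (N : ℤ) - i - k - 1) (by omega) (by omega)
      (by push_cast; ring), upperEntry_eq (N := N) (k := k) rfl rfl rfl, smul_mul_assoc,
    orderedMonomial_mul_val hq h, smul_smul, sub_add_cancel]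
  congr 1
  field_simp
  ring

/-- Entries of `ker_mul` in the columns `(j, 1)`; away from the diagonal this is Pascal's rule. -/
lemma upperEntry_mul_sub (hq : q ≠ 0) (h : b * (a : 𝒜) = q • ((a : 𝒜) * b))
    (hi : i < m) :
    upperEntry q a b (m + 1) (i + 1) j * b -
      q ^ (i + 1) • (upperEntry q a b (m + 1) i j * ((a⁻¹ : 𝒜ˣ) : 𝒜)) =
      -(q ^ (j + 1) • upperEntry q a b m i j) := by
  obtain ⟨N, rfl⟩ := Nat.exists_eq_add_of_lt hi
  obtain hj | hj := lt_or_ge j i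
  · simp [upperEntry_of_lt hj, upperEntry_of_lt (Nat.lt_succ_of_lt hj)]
  obtain ⟨k, rfl⟩ := Nat.exists_eq_add_of_le hj
  rw [upperEntry_eq (N := N + 1) (k := k) (by omega) rfl rfl,
    upperEntry_eq (N := N) (k := k) (e := ((N + 1 : ℕ) : ℤ) - i - k - 1) rfl rfl
      (by push_cast; ring), smul_mul_assoc, orderedMonomial_mul_inv hq h]
  cases k with
  | zero =>
    rw [upperEntry_of_lt (by omega)]
    simp
  | succ k =>
    rw [upperEntry_eq (N := N) (k := k) (by omega) (by omega) rfl, smul_mul_assoc,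
      orderedMonomial_mul_right, gaussBinom_succ_succ]
    simp only [smul_smul, ← neg_smul]
    rw [show (N : ℤ) - (i + 1 : ℕ) - k = (N + 1 : ℕ) - i - (k + 1 : ℕ) - 1 by push_cast; ring,
      ← sub_smul]
    congr 1
    field_simp
    ring

lemma upperEntry_mul_add (hq : q ≠ 0) (h : b * (a : 𝒜) = q • ((a : 𝒜) * b))
    (hi : i ≤ m) :
    q ^ (j + 1) • (upperEntry q a b (m + 1) i (j + 1) * a) + upperEntry q a b (m + 1) i j * b =
      q ^ i • upperEntry q a b (m + 2) i (j + 1) := by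
  obtain ⟨N, rfl⟩ := Nat.exists_eq_add_of_le hi
  obtain hj | hj := lt_or_ge (j + 1) i
  · simp [upperEntry_of_lt hj, upperEntry_of_lt (show j < i by omega)]
  obtain ⟨k, hk⟩ := Nat.exists_eq_add_of_le hj
  rw [upperEntry_eq (N := N) (k := k) rfl hk rfl,
    upperEntry_eq (N := N + 1) (k := k) (e := (N : ℤ) - i - k + 1) (by omega) hk
      (by push_cast; ring), smul_mul_assoc, orderedMonomial_mul_val hq h]
  cases k with
  | zero =>
    rw [upperEntry_of_lt (by omega)]
    simp only [smul_smul, zero_mul, add_zero]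
    simp [hk]
  | succ k =>
    obtain rfl : j = i + k := by omega
    rw [upperEntry_eq (N := N) (k := k) (by omega) (by omega) rfl, smul_mul_assoc,
      orderedMonomial_mul_right, gaussBinom_succ_succ]
    simp only [smul_smul]
    rw [show (N : ℤ) - i - (k + 1 : ℕ) + 1 = N - i - k by push_cast; ring, ← add_smul]
    congr 1
    field_simp
    ring

lemma upperEntry_mul_inv (hq : q ≠ 0) (h : b * (a : 𝒜) = q • ((a : 𝒜) * b))
    (hi : i ≤ m) :
    upperEntry q a b (m + 1) i j * ((a⁻¹ : 𝒜ˣ) : 𝒜) =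
      upperEntry q a b (m + 2) (i + 1) (j + 1) := by
  obtain ⟨N, rfl⟩ := Nat.exists_eq_add_of_le hi
  obtain hj | hj := lt_or_ge j i
  · rw [upperEntry_of_lt hj, upperEntry_of_lt (by omega), zero_mul]
  obtain ⟨k, rfl⟩ := Nat.exists_eq_add_of_le hj
  rw [upperEntry_eq (N := N) (k := k) rfl rfl rfl,
    upperEntry_eq (N := N) (k := k) (e := (N : ℤ) - i - k - 1) (by omega) (by omega)
      (by push_cast; ring), smul_mul_assoc,
    orderedMonomial_mul_inv hq h, smul_smul]
  congr 1
  field_simp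
  ring

lemma upperEntry_zero_mul_val (hq : q ≠ 0) (h : b * (a : 𝒜) = q • ((a : 𝒜) * b)) :
    upperEntry q a b (m + 1) i 0 * a = q ^ i • upperEntry q a b (m + 2) i 0 := by
  cases i with
  | zero =>
    rw [upperEntry_eq (N := m) (k := 0) (by omega) rfl rfl,
      upperEntry_eq (N := m + 1) (k := 0) (e := (m : ℤ) - (0 : ℕ) - (0 : ℕ) + 1) (by omega) rfl
        (by push_cast; ring), smul_mul_assoc, orderedMonomial_mul_val hq h]
    simp
  | succ i => simp [upperEntry_of_lt (Nat.succ_pos i)]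

lemma lowerEntry_mul_sub (hq : q ≠ 0) (h : b * (a : 𝒜) = q • ((a : 𝒜) * b)) :
    lowerEntry q a b (m + 1) (i + 1) (j + 1) * a -
      q ^ (i + 1) • (lowerEntry q a b (m + 1) i (j + 1) * b) = lowerEntry q a b m i j := by
  obtain hj | hj := lt_or_ge i j
  · simp [lowerEntry_of_lt hj, lowerEntry_of_lt (Nat.succ_lt_succ hj),
      lowerEntry_of_lt (Nat.lt_succ_of_lt hj)]
  obtain ⟨k, rfl⟩ := Nat.exists_eq_add_of_le hj
  rw [lowerEntry_eq (k := k) (e := (m : ℤ) - 1 - 2 * j - k - 1) (by omega) (by push_cast; ring),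
    lowerEntry_eq (m := m) (k := k) rfl rfl, smul_mul_assoc, orderedMonomial_mul_val hq h,
    sub_add_cancel]
  cases k with
  | zero =>
    rw [lowerEntry_of_lt (by omega)]
    simp
  | succ k =>
    rw [lowerEntry_eq (k := k) (e := (m : ℤ) - 1 - 2 * j - (k + 1 : ℕ)) (by omega)
      (by push_cast; ring), smul_mul_assoc, orderedMonomial_mul_right, gaussBinom_succ_succ]
    simp only [smul_smul]
    rw [← sub_smul]
    congr 1
    field_simp
    ring

lemma lowerEntry_zero_mul_sub (hq : q ≠ 0) (h : b * (a : 𝒜) = q • ((a : 𝒜) * b)) :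
    lowerEntry q a b (m + 1) (i + 1) 0 * a -
      q ^ (i + 1) • (lowerEntry q a b (m + 1) i 0 * b) = 0 := by
  rw [lowerEntry_eq (k := i + 1) (e := (m : ℤ) - i - 1) (by omega) (by push_cast; ring),
    lowerEntry_eq (k := i) (e := (m : ℤ) - i - 1 + 1) (by omega) (by push_cast; ring),
    smul_mul_assoc, orderedMonomial_mul_val hq h, smul_mul_assoc, orderedMonomial_mul_right]
  simp

lemma lowerEntry_zero_mul :
    lowerEntry q a b (m + 1) i 0 * b = lowerEntry q a b (m + 2) (i + 1) 0 := by
  rw [lowerEntry_eq (k := i) (e := (m : ℤ) - i) (by omega) (by push_cast; ring),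
    lowerEntry_eq (m := m + 2) (k := i + 1) (e := (m : ℤ) - i) (by omega)
    (by push_cast; ring), smul_mul_assoc, orderedMonomial_mul_right]
  simp

lemma lowerEntry_mul_inv (hq : q ≠ 0) (h : b * (a : 𝒜) = q • ((a : 𝒜) * b)) :
    q ^ (i + 1) • (lowerEntry q a b (m + 1) i j * ((a⁻¹ : 𝒜ˣ) : 𝒜)) =
      q ^ (j + 1) • lowerEntry q a b m i j := by
  obtain hj | hj := lt_or_ge i j
  · simp [lowerEntry_of_lt hj]
  obtain ⟨k, rfl⟩ := Nat.exists_eq_add_of_le hj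
  rw [lowerEntry_eq (k := k) (e := (m : ℤ) - 1 - 2 * j - k + 1) rfl (by push_cast; ring),
    lowerEntry_eq (m := m) (k := k) rfl rfl, smul_mul_assoc, orderedMonomial_mul_inv hq h,
    add_sub_cancel_right]
  simp only [smul_smul]
  congr 1
  field_simp
  ring

lemma lowerEntry_mul_val (hq : q ≠ 0) (h : b * (a : 𝒜) = q • ((a : 𝒜) * b)) :
    q ^ j • (lowerEntry q a b (m + 1) i j * a) = q ^ i • lowerEntry q a b (m + 2) i j := by
  obtain hj | hj := lt_or_ge i j
  · simp [lowerEntry_of_lt hj]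
  obtain ⟨k, rfl⟩ := Nat.exists_eq_add_of_le hj
  rw [lowerEntry_eq (k := k) (e := (m : ℤ) - 2 * j - k) rfl (by push_cast; ring),
    lowerEntry_eq (m := m + 2) (k := k) (e := (m : ℤ) - 2 * j - k + 1) rfl (by push_cast; ring),
    smul_mul_assoc, orderedMonomial_mul_val hq h]
  simp only [smul_smul]
  congr 1
  field_simp
  ring

lemma lowerEntry_mul_add (hq : q ≠ 0) (h : b * (a : 𝒜) = q • ((a : 𝒜) * b)) :
    q ^ (j + 1) • (lowerEntry q a b (m + 1) i (j + 1) * b) +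
      lowerEntry q a b (m + 1) i j * ((a⁻¹ : 𝒜ˣ) : 𝒜) =
      lowerEntry q a b (m + 2) (i + 1) (j + 1) := by
  obtain hj | hj := lt_or_ge i j
  · simp [lowerEntry_of_lt hj, lowerEntry_of_lt (Nat.succ_lt_succ hj),
      lowerEntry_of_lt (Nat.lt_succ_of_lt hj)]
  obtain ⟨k, rfl⟩ := Nat.exists_eq_add_of_le hj
  rw [lowerEntry_eq (j := j) (k := k) (e := (m : ℤ) - 2 * j - k) (by omega) (by push_cast; ring),
    lowerEntry_eq (m := m + 2) (k := k) (e := (m : ℤ) - 2 * j - k - 1) (by omega)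
      (by push_cast; ring), smul_mul_assoc, orderedMonomial_mul_inv hq h]
  cases k with
  | zero =>
    rw [lowerEntry_of_lt (by omega)]
    simp
  | succ k =>
    rw [lowerEntry_eq (k := k) (e := (m : ℤ) - 2 * j - (k + 1 : ℕ) - 1) (by omega)
      (by push_cast; ring), smul_mul_assoc, orderedMonomial_mul_right, gaussBinom_succ_succ]
    simp only [smul_smul]
    rw [← add_smul]
    congr 1
    field_simp
    ring

/-- Put `k = j - i`. In Pascal's rule for the larger entry, the term with factor `q ^ (2 * k)` is
exactly `q ^ k` times the smaller entry; the other term remains. -/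
lemma upperEntry_sub (hq : q ≠ 0) (hi : i < m) :
    upperEntry q a b (m + 2) (i + 1) (j + 1) - q ^ ((j : ℤ) - i) • upperEntry q a b m i j =
      if i < j then (gaussBinom (q ^ 2) (m - 1 - i) (j - i - 1) * (q ^ ((i + 1) * (j - i)))⁻¹) •
        orderedMonomial a b ((m : ℤ) - 1 - i - j) (j - i) else 0 := by
  obtain ⟨N, rfl⟩ := Nat.exists_eq_add_of_lt hi
  obtain hj | hj := lt_or_ge j i
  · rw [upperEntry_of_lt hj, upperEntry_of_lt (by omega), if_neg (by omega), smul_zero, sub_zero]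
  obtain ⟨k, rfl⟩ := Nat.exists_eq_add_of_le hj
  rw [upperEntry_eq (N := N + 1) (k := k) (e := (N : ℤ) - i - k) (by omega) (by omega)
    (by push_cast; ring), upperEntry_eq (N := N) (k := k) rfl rfl rfl,
    show ((i + k : ℕ) : ℤ) - i = k by push_cast; ring, zpow_natCast]
  cases k with
  | zero => simp
  | succ k =>
    rw [if_pos (by omega), smul_smul, ← sub_smul, show i + N + 1 - 1 - i = N by omega,
      Nat.add_sub_cancel_left, Nat.add_sub_cancel, gaussBinom_succ_succ,
      show ((i + N + 1 : ℕ) : ℤ) - 1 - i - (i + (k + 1) : ℕ) = N - i - (k + 1 : ℕ) by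
        push_cast; ring]
    congr 1
    field_simp
    ring

/-- Here the first term of Pascal's rule is the rescaled smaller entry, and the term with the power
of `q ^ 2` remains. -/
lemma lowerEntry_sub (hq : q ≠ 0) :
    lowerEntry q a b (m + 2) (i + 1) (j + 1) - q ^ ((j : ℤ) - i) • lowerEntry q a b m i j =
      if j < i then (q ^ (2 * (j + 1)) * gaussBinom (q ^ 2) i (j + 1) *
        (q ^ ((j + 1) * (i - j)))⁻¹) •
        orderedMonomial a b ((m : ℤ) - 1 - i - j) (i - j) else 0 := by
  obtain hj | hj := lt_or_ge i j
  · rw [lowerEntry_of_lt hj, lowerEntry_of_lt (by omega), if_neg (by omega), smul_zero, sub_zero]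
  obtain ⟨k, rfl⟩ := Nat.exists_eq_add_of_le hj
  rw [lowerEntry_eq (j := j + 1) (k := k) (e := (m : ℤ) - 1 - 2 * j - k) (by omega)
    (by push_cast; ring), lowerEntry_eq (k := k) rfl rfl,
    show (j : ℤ) - (j + k : ℕ) = -k by push_cast; ring, _root_.zpow_neg, zpow_natCast]
  cases k with
  | zero => simp
  | succ k =>
    rw [if_pos (by omega), smul_smul, ← sub_smul,
      Nat.add_sub_cancel_left, gaussBinom_succ_succ,
      show (m : ℤ) - 1 - (j + (k + 1) : ℕ) - j = m - 1 - 2 * j - (k + 1 : ℕ) by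
        push_cast; ring]
    congr 1
    field_simp
    ring

end symPower

/-! ### Triangular matrices have symmetric power families. -/

section symPower

open Matrix
open scoped Kronecker

variable {𝒜 : Type*} [Ring 𝒜] [Algebra ℂ 𝒜] {q : ℂ} {a : 𝒜ˣ} {b : 𝒜}

lemma algebraMap_smul_orderedMonomial_mem {S : Subsemiring 𝒜} (ha : (a : 𝒜) ∈ S)
    (ha' : ((a⁻¹ : 𝒜ˣ) : 𝒜) ∈ S) (hb : b ∈ S) {c : ℂ} (hc : algebraMap ℂ 𝒜 c ∈ S) (z : ℤ) (k : ℕ) :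
    c • orderedMonomial a b z k ∈ S := by
  rw [Algebra.smul_def]
  exact S.mul_mem hc (orderedMonomial_mem S ha ha' hb z k)

lemma gaussBinom_mul_mem {S : Subsemiring 𝒜} (hS : ∀ z : ℤ, algebraMap ℂ 𝒜 (q ^ z) ∈ S)
    (n k l : ℕ) : algebraMap ℂ 𝒜 (gaussBinom (q ^ 2) n k * (q ^ l)⁻¹) ∈ S := by
  rw [map_mul]
  refine S.mul_mem ?_ (by simpa using hS (-l))
  exact gaussBinom_mem (q ^ 2) (S.comap (algebraMap ℂ 𝒜)) (by simpa using hS 2) n k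

lemma isSymPowerFamily_upper (hq : q ≠ 0) (h : b * (a : 𝒜) = q • ((a : 𝒜) * b)) :
    IsSymPowerFamily q a b !![(a : 𝒜), b; 0, ((a⁻¹ : 𝒜ˣ) : 𝒜)]
      fun m => of fun i j => upperEntry q a b m i j where
  one := by
    ext i j
    fin_cases i; fin_cases j
    simp [upperEntry, orderedMonomial]
  ker_mul m := by
    ext i ⟨j, d⟩
    rw [quantumKer_mul_apply]
    fin_cases d
    · refine Fin.cases ?_ (fun j => ?_) j
      · erw [mul_quantumKer_apply_zero]
        simp [upperEntry_of_lt]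
      · erw [mul_quantumKer_apply_succ]
        simp [upperEntry_mul_val hq h i.2]
    · refine Fin.lastCases ?_ (fun j => ?_) j
      · erw [mul_quantumKer_apply_last]
        simpa [upperEntry_of_le le_rfl i.2] using upperEntry_mul_sub hq h (j := m) i.2
      · erw [mul_quantumKer_apply_castSucc]
        simpa using upperEntry_mul_sub hq h (j := j) i.2
  mul_mul m := by
    ext ⟨i, c⟩ j
    have hi : (i : ℕ) ≤ m := by omega
    fin_cases c
    · erw [quantumMul_mul_apply_zero]
      refine Fin.cases ?_ (fun j => Fin.lastCases ?_ (fun j => ?_) j) j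
      · rw [mul_quantumMul_apply_zero]
        simpa using upperEntry_zero_mul_val hq h
      · rw [mul_quantumMul_apply_last]
        simpa [upperEntry_of_le (show m + 1 ≤ m + 1 from le_rfl) i.2]
          using upperEntry_mul_add hq h (j := m) hi
      · rw [mul_quantumMul_apply_castSucc_succ]
        simpa using upperEntry_mul_add hq h (j := j) hi
    · erw [quantumMul_mul_apply_one]
      refine Fin.cases ?_ (fun j => Fin.lastCases ?_ (fun j => ?_) j) j
      · rw [mul_quantumMul_apply_zero]
        simp [upperEntry_of_lt]
      · rw [mul_quantumMul_apply_last]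
        simpa using upperEntry_mul_inv hq h (j := m) hi
      · rw [mul_quantumMul_apply_castSucc_succ]
        simpa using upperEntry_mul_inv hq h (j := j) hi
  commute ha hb m i j := by
    simp only [of_apply, upperEntry]
    split_ifs
    · exact (ha.orderedMonomial_left hb _ _).smul_left _
    · exact Commute.zero_left _
  entry_commute ha hb c d := by
    fin_cases c <;> fin_cases d
    exacts [ha, hb, Commute.zero_left _, ha.units_inv_left]
  mem S ha ha' hb hS m i j := by
    simp only [of_apply, upperEntry]
    split_ifs
    · exact algebraMap_smul_orderedMonomial_mem ha ha' hb (gaussBinom_mul_mem hS _ _ _) _ _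
    · exact S.zero_mem
  sub_mem S ha ha' hb hS m i j := by
    have := upperEntry_sub (a := a) (b := b) (j := j) hq i.2
    simp only [of_apply, Fin.val_succ, Fin.val_castSucc, this]
    split_ifs
    · exact algebraMap_smul_orderedMonomial_mem ha ha' hb (gaussBinom_mul_mem hS _ _ _) _ _
    · exact S.zero_mem

lemma isSymPowerFamily_lower (hq : q ≠ 0) (h : b * (a : 𝒜) = q • ((a : 𝒜) * b)) :
    IsSymPowerFamily q a b !![(a : 𝒜), 0; b, ((a⁻¹ : 𝒜ˣ) : 𝒜)]
      fun m => of fun i j => lowerEntry q a b m i j where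
  one := by
    ext i j
    fin_cases i; fin_cases j
    simp [lowerEntry, orderedMonomial]
  ker_mul m := by
    ext i ⟨j, d⟩
    rw [quantumKer_mul_apply]
    fin_cases d
    · refine Fin.cases ?_ (fun j => ?_) j
      · erw [mul_quantumKer_apply_zero]
        simpa using lowerEntry_zero_mul_sub hq h
      · erw [mul_quantumKer_apply_succ]
        simpa using lowerEntry_mul_sub hq h (j := j)
    · refine Fin.lastCases ?_ (fun j => ?_) j
      · erw [mul_quantumKer_apply_last]
        simp [lowerEntry_of_lt i.2]
      · erw [mul_quantumKer_apply_castSucc]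
        simpa using lowerEntry_mul_inv hq h (j := j)
  mul_mul m := by
    ext ⟨i, c⟩ j
    fin_cases c
    · erw [quantumMul_mul_apply_zero]
      refine Fin.cases ?_ (fun j => Fin.lastCases ?_ (fun j => ?_) j) j
      · rw [mul_quantumMul_apply_zero]
        simpa using lowerEntry_mul_val hq h (j := 0)
      · rw [mul_quantumMul_apply_last]
        simp [lowerEntry_of_lt i.2]
      · rw [mul_quantumMul_apply_castSucc_succ]
        simpa using lowerEntry_mul_val hq h (j := j + 1)
    · erw [quantumMul_mul_apply_one]
      refine Fin.cases ?_ (fun j => Fin.lastCases ?_ (fun j => ?_) j) j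
      · rw [mul_quantumMul_apply_zero]
        simpa using lowerEntry_zero_mul
      · rw [mul_quantumMul_apply_last]
        simpa [lowerEntry_of_lt i.2] using lowerEntry_mul_add hq h (m := m) (i := i) (j := m)
      · rw [mul_quantumMul_apply_castSucc_succ]
        simpa using lowerEntry_mul_add hq h (j := j)
  commute ha hb m i j := by
    simp only [of_apply, lowerEntry]
    split_ifs
    · exact (ha.orderedMonomial_left hb _ _).smul_left _
    · exact Commute.zero_left _
  entry_commute ha hb c d := by
    fin_cases c <;> fin_cases d
    exacts [ha, Commute.zero_left _, hb, ha.units_inv_left]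
  mem S ha ha' hb hS m i j := by
    simp only [of_apply, lowerEntry]
    split_ifs
    · exact algebraMap_smul_orderedMonomial_mem ha ha' hb (gaussBinom_mul_mem hS _ _ _) _ _
    · exact S.zero_mem
  sub_mem S ha ha' hb hS m i j := by
    have := lowerEntry_sub (a := a) (b := b) (m := m) (i := i) (j := j) hq
    simp only [of_apply, Fin.val_succ, Fin.val_castSucc, this]
    split_ifs
    · refine algebraMap_smul_orderedMonomial_mem ha ha' hb ?_ _ _
      rw [mul_assoc, map_mul]
      exact S.mul_mem (hS (2 * (j + 1) : ℕ)) (gaussBinom_mul_mem hS _ _ _)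
    · exact S.zero_mem

end symPower

/-! ### Products of factors and Chebyshev polynomials of the trace. -/

section listProd

open Matrix
open scoped Kronecker

lemma Matrix.commute_list_prod_apply {R n : Type*} [Ring R] [Fintype n] [DecidableEq n]
    {x : R} (l : List (Matrix n n R)) (h : ∀ X ∈ l, ∀ i j, Commute x (X i j)) (i j : n) :
    Commute x (l.prod i j) := by
  induction l generalizing i with
  | nil =>
    rw [List.prod_nil, one_apply]
    split_ifs
    exacts [Commute.one_right x, Commute.zero_right x]
  | cons X l ih =>
    rw [List.prod_cons, mul_apply]
    exact Commute.sum_right _ _ _ fun y _ => (h X (by simp) _ _).mul_right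
      (ih (fun Y hY => h Y (by simp [hY])) _)

lemma Matrix.list_prod_apply_mem {R n : Type*} [Ring R] [Fintype n] [DecidableEq n]
    (S : Subsemiring R) (l : List (Matrix n n R)) (h : ∀ X ∈ l, ∀ i j, X i j ∈ S) (i j : n) :
    l.prod i j ∈ S := by
  induction l generalizing i with
  | nil =>
    rw [List.prod_nil, one_apply]
    split_ifs
    exacts [S.one_mem, S.zero_mem]
  | cons X l ih =>
    rw [List.prod_cons, mul_apply]
    exact S.sum_mem fun y _ => S.mul_mem (h X (by simp) _ _)
      (ih (fun Y hY => h Y (by simp [hY])) _)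

variable {𝒜 : Type*} [Ring 𝒜] [Algebra ℂ 𝒜] {q : ℂ} {k : ℕ}
  {a : Fin k → 𝒜ˣ} {b : Fin k → 𝒜} {A : Fin k → Matrix (Fin 2) (Fin 2) 𝒜}
  {R : Fin k → ∀ m : ℕ, Matrix (Fin m) (Fin m) 𝒜}

lemma quantumKer_mul_list_prod (hR : ∀ i, IsSymPowerFamily q (a i) (b i) (A i) (R i))
    (hc : ∀ i j, i ≠ j → ∀ c d m s t, Commute (A i c d) (R j m s t)) (m : ℕ) :
    quantumKer 𝒜 q m * ((List.ofFn fun i => R i (m + 1)).prod ⊗ₖ (List.ofFn A).prod) =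
      (List.ofFn fun i => R i m).prod * quantumKer 𝒜 q m := by
  induction k with
  | zero => simp
  | succ k ih =>
    simp only [List.ofFn_succ, List.prod_cons]
    rw [← kronecker_mul_kronecker_of_commute, ← Matrix.mul_assoc, (hR 0).ker_mul,
      Matrix.mul_assoc, ih (fun i => hR i.succ)
        fun i j hij => hc _ _ fun e => hij (Fin.succ_injective _ e), Matrix.mul_assoc]
    intro c d s t
    refine commute_list_prod_apply _ (fun X hX => ?_) s t
    obtain ⟨i, rfl⟩ := (List.mem_ofFn' _ _).1 hX
    exact hc _ _ (Fin.succ_ne_zero i).symm c d _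

lemma list_prod_mul_quantumMul (hR : ∀ i, IsSymPowerFamily q (a i) (b i) (A i) (R i))
    (hc : ∀ i j, i ≠ j → ∀ c d m s t, Commute (A i c d) (R j m s t)) (m : ℕ) :
    ((List.ofFn fun i => R i (m + 1)).prod ⊗ₖ (List.ofFn A).prod) * quantumMul 𝒜 q m =
      quantumMul 𝒜 q m * (List.ofFn fun i => R i (m + 2)).prod := by
  induction k with
  | zero => simp
  | succ k ih =>
    simp only [List.ofFn_succ, List.prod_cons]
    rw [← kronecker_mul_kronecker_of_commute, Matrix.mul_assoc, ih (fun i => hR i.succ)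
        fun i j hij => hc _ _ fun e => hij (Fin.succ_injective _ e), ← Matrix.mul_assoc,
      (hR 0).mul_mul, Matrix.mul_assoc]
    intro c d s t
    refine commute_list_prod_apply _ (fun X hX => ?_) s t
    obtain ⟨i, rfl⟩ := (List.mem_ofFn' _ _).1 hX
    exact hc _ _ (Fin.succ_ne_zero i).symm c d _

/-- The Chebyshev polynomials of the second kind in the trace are the traces of the action on the
homogeneous polynomials in the quantum plane. -/
lemma aeval_trace_chebyshev_S (hR : ∀ i, IsSymPowerFamily q (a i) (b i) (A i) (R i))
    (hc : ∀ i j, i ≠ j → ∀ c d m s t, Commute (A i c d) (R j m s t)) (n : ℕ) :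
    Polynomial.aeval (List.ofFn A).prod.trace (Polynomial.Chebyshev.S ℤ ((n : ℤ) - 1)) =
      (List.ofFn fun i => R i n).prod.trace := by
  induction n using Nat.twoStepInduction with
  -- The shift by one starts the induction at `S (-1) = 0`, the trace of an empty matrix.
  | zero => simp [trace]
  | one =>
    have : (fun i => R i 1) = fun _ => 1 := funext fun i => (hR i).one
    simp [this]
  | more n h0 h1 =>
    have key := trace_eq_add_of_intertwine (quantumKer_mul_list_prod hR hc n)
      (list_prod_mul_quantumMul hR hc n)
    rw [trace_kronecker, ← h0, ← h1] at key
    rw [← sub_eq_iff_eq_add'.2 key, show ((n + 2 : ℕ) : ℤ) - 1 = ((n + 1 : ℕ) : ℤ) - 1 + 1 by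
      push_cast; ring, Polynomial.Chebyshev.S_add_one, mul_comm, map_sub, map_mul,
      Polynomial.aeval_X, show ((n + 1 : ℕ) : ℤ) - 1 - 1 = (n : ℤ) - 1 by push_cast; ring]

lemma list_prod_sub_mem (hR : ∀ i, IsSymPowerFamily q (a i) (b i) (A i) (R i))
    (hq : q ≠ 0) (S : Subsemiring 𝒜) (ha : ∀ i, (a i : 𝒜) ∈ S)
    (ha' : ∀ i, (((a i)⁻¹ : 𝒜ˣ) : 𝒜) ∈ S) (hb : ∀ i, b i ∈ S)
    (hS : ∀ z : ℤ, algebraMap ℂ 𝒜 (q ^ z) ∈ S) (m : ℕ) (s t : Fin m) :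
    (List.ofFn fun i => R i (m + 2)).prod s.castSucc.succ t.castSucc.succ -
      q ^ ((t : ℤ) - s) • (List.ofFn fun i => R i m).prod s t ∈ S := by
  induction k generalizing s with
  | zero =>
    by_cases hst : s = t
    · simp [hst]
    · simp [hst, one_apply]
  | succ k ih =>
    have mem (i : Fin (k + 1)) := (hR i).mem S (ha i) (ha' i) (hb i) hS
    have memP (n : ℕ) (u v : Fin n) : (List.ofFn fun i : Fin k => R i.succ n).prod u v ∈ S := by
      refine list_prod_apply_mem S _ (fun X hX => ?_) u v
      obtain ⟨i, rfl⟩ := (List.mem_ofFn' _ _).1 hX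
      exact mem _ _
    simp only [List.ofFn_succ, List.prod_cons, mul_apply]
    rw [Fin.sum_univ_succ, Fin.sum_univ_castSucc, Fin.succ_last]
    -- The first and last intermediate indices give terms already in `S`; the inner ones are paired
    -- with those of the smaller product.
    rw [add_sub_assoc, add_sub_right_comm, Finset.smul_sum, ← Finset.sum_sub_distrib]
    refine S.add_mem (S.mul_mem (mem _ _ _ _) (memP _ _ _)) (S.add_mem (S.sum_mem fun u _ => ?_)
      (S.mul_mem (mem _ _ _ _) (memP _ _ _)))
    have h1 := (hR 0).sub_mem S (ha 0) (ha' 0) (hb 0) hS m s u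
    have h2 := ih (fun i => hR i.succ) (fun i => ha _) (fun i => ha' _) (fun i => hb _) u
    have h3 : q ^ ((u : ℤ) - s) • R 0 m s u ∈ S := by
      rw [Algebra.smul_def]; exact S.mul_mem (hS _) (mem _ _ _ _)
    -- Telescoping `X Y - X' Y' = (X - X') Y + X' (Y - Y')`, where the primes denote rescaled
    -- smaller entries.
    have := S.add_mem (S.mul_mem h1 (memP _ u.castSucc.succ t.castSucc.succ)) (S.mul_mem h3 h2)
    convert this using 1
    rw [sub_mul, mul_sub, smul_mul_smul_comm, ← zpow_add₀ hq]
    rw [show (u : ℤ) - s + (t - u) = t - s by ring]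
    abel

lemma aeval_trace_chebyshev_mem (hR : ∀ i, IsSymPowerFamily q (a i) (b i) (A i) (R i))
    (hc : ∀ i j, i ≠ j → ∀ c d m s t, Commute (A i c d) (R j m s t))
    (hq : q ≠ 0) (S : Subsemiring 𝒜) (ha : ∀ i, (a i : 𝒜) ∈ S)
    (ha' : ∀ i, (((a i)⁻¹ : 𝒜ˣ) : 𝒜) ∈ S) (hb : ∀ i, b i ∈ S)
    (hS : ∀ z : ℤ, algebraMap ℂ 𝒜 (q ^ z) ∈ S) (n : ℕ) :
    Polynomial.aeval (List.ofFn A).prod.trace (Polynomial.Chebyshev.S ℤ n) ∈ S ∧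
      Polynomial.aeval (List.ofFn A).prod.trace (Polynomial.Chebyshev.C ℤ n) ∈ S := by
  have memP (m : ℕ) (u v : Fin m) : (List.ofFn fun i => R i m).prod u v ∈ S := by
    refine list_prod_apply_mem S _ (fun X hX => ?_) u v
    obtain ⟨i, rfl⟩ := (List.mem_ofFn' _ _).1 hX
    exact (hR i).mem S (ha i) (ha' i) (hb i) hS m
  have hSn : Polynomial.aeval (List.ofFn A).prod.trace (Polynomial.Chebyshev.S ℤ n) ∈ S := by
    have := aeval_trace_chebyshev_S hR hc (n + 1)
    rw [Nat.cast_succ, add_sub_cancel_right] at this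
    rw [this]
    exact S.sum_mem fun i _ => memP _ _ _
  refine ⟨hSn, ?_⟩
  -- `C 0 = 2` is separate: `S 0 - S (-2)` would involve `S (-2) = -1`, outside the range of the
  -- trace formula.
  match n with
  | 0 =>
    rw [Nat.cast_zero, Polynomial.Chebyshev.C_zero, map_ofNat]
    exact ofNat_mem S 2
  | n + 1 =>
    have : Polynomial.Chebyshev.C ℤ (n + 1 : ℕ) = Polynomial.Chebyshev.S ℤ ((n + 2 : ℕ) - 1) -
        Polynomial.Chebyshev.S ℤ ((n : ℤ) - 1) := by
      rw [Polynomial.Chebyshev.C_eq_S_sub_X_mul_S, show ((n + 2 : ℕ) : ℤ) - 1 = n + 1 by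
        push_cast; ring, Nat.cast_succ, add_sub_cancel_right, Polynomial.Chebyshev.S_add_one]
      ring
    rw [this, map_sub, aeval_trace_chebyshev_S hR hc, aeval_trace_chebyshev_S hR hc]
    simp only [trace, diag_apply]
    rw [Fin.sum_univ_succ, Fin.sum_univ_castSucc, add_sub_assoc, add_sub_right_comm,
      ← Finset.sum_sub_distrib]
    refine S.add_mem (memP _ _ _) (S.add_mem (S.sum_mem fun u _ => ?_) (memP _ _ _))
    -- On the diagonal the rescaling factor is `q ^ (u - u) = 1`.
    simpa using list_prod_sub_mem hR hq S ha ha' hb hS n u u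

end listProd

/-! ### The semiring of positive sums of monomials. -/

section monomials

variable {𝒜 : Type*} [Ring 𝒜]

lemma List.prod_ofFn_mul_prod_ofFn {k : ℕ} (u v : Fin k → 𝒜)
    (h : ∀ i j, i ≠ j → Commute (u i) (v j)) :
    (List.ofFn u).prod * (List.ofFn v).prod = (List.ofFn fun i => u i * v i).prod := by
  induction k with
  | zero => simp
  | succ k ih =>
    have hc : Commute (List.ofFn fun i : Fin k => u i.succ).prod (v 0) :=
      Commute.list_prod_left _ _ fun x hx => by
        obtain ⟨i, rfl⟩ := (List.mem_ofFn' _ _).1 hx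
        exact h _ _ (Fin.succ_ne_zero i)
    simp only [List.ofFn_succ, List.prod_cons]
    rw [← ih _ _ fun i j hij => h _ _ fun e => hij (Fin.succ_injective _ e), mul_assoc,
      ← mul_assoc _ (v 0), hc.eq]
    simp only [mul_assoc]

lemma List.prod_ofFn_ite_eq {k : ℕ} (i : Fin k) (x : 𝒜) :
    (List.ofFn fun j => if j = i then x else 1).prod = x := by
  induction k with
  | zero => exact i.elim0
  | succ k ih =>
    refine Fin.cases ?_ (fun i => ?_) i
    · simp [List.ofFn_succ, Fin.succ_ne_zero]
    · simp [List.ofFn_succ, ih, (Fin.succ_ne_zero _).symm]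

variable [Algebra ℂ 𝒜] {q : ℂ} {k : ℕ} {a : Fin k → 𝒜ˣ} {b : Fin k → 𝒜}

lemma exists_prod_ofFn_zpow_smul (hq : q ≠ 0) (e : Fin k → ℤ) (w : Fin k → 𝒜) :
    ∃ ξ : ℤ, (List.ofFn fun i => q ^ e i • w i).prod = q ^ ξ • (List.ofFn w).prod := by
  induction k with
  | zero => exact ⟨0, by simp⟩
  | succ k ih =>
    obtain ⟨ξ, hξ⟩ := ih (fun i => e i.succ) fun i => w i.succ
    refine ⟨e 0 + ξ, ?_⟩
    simp only [List.ofFn_succ, List.prod_cons]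
    rw [hξ, smul_mul_smul_comm, zpow_add₀ hq]

/-- The monomials form a submonoid. -/
def qMonomialSubmonoid (hq : q ≠ 0) (hba : ∀ i, b i * (a i : 𝒜) = q • ((a i : 𝒜) * b i))
    (haa : ∀ i j, i ≠ j → Commute (a i : 𝒜) (a j : 𝒜))
    (hab : ∀ i j, i ≠ j → Commute (a i : 𝒜) (b j))
    (hbb : ∀ i j, i ≠ j → Commute (b i) (b j)) : Submonoid 𝒜 where
  carrier := {x | ∃ ξ α β, x = qMonomial q a b ξ α β}
  one_mem' := ⟨0, 0, 0, by simp [qMonomial]⟩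
  mul_mem' := by
    rintro _ _ ⟨ξ, α, β, rfl⟩ ⟨ξ', α', β', rfl⟩
    obtain ⟨ζ, hζ⟩ := exists_prod_ofFn_zpow_smul hq (fun i => β i * α' i)
      fun i => ((a i ^ (α i + α' i) : 𝒜ˣ) : 𝒜) * b i ^ (β i + β' i)
    refine ⟨ξ + ξ' + ζ, α + α', β + β', ?_⟩
    simp only [qMonomial, Pi.add_apply]
    rw [smul_mul_smul_comm, ← zpow_add₀ hq, List.prod_ofFn_mul_prod_ofFn, zpow_add₀ hq _ ζ,
      mul_smul, ← hζ]
    · congr 3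
      funext i
      exact orderedMonomial_mul hq (hba i) _ _ _ _
    · intro i j hij
      refine Commute.orderedMonomial_left (Commute.symm ?_) (Commute.symm ?_) _ _
      · exact Commute.orderedMonomial_left (haa j i hij.symm) (hab i j hij).symm _ _
      · exact Commute.orderedMonomial_left (hab j i hij.symm) (hbb j i hij.symm) _ _

lemma isSumOfPositiveMonomials_of_mem_closure {x : 𝒜}
    (hx : x ∈ AddSubmonoid.closure {x | ∃ ξ α β, x = qMonomial q a b ξ α β}) :
    IsSumOfPositiveMonomials q a b x := by
  obtain ⟨l, hl, rfl⟩ := AddSubmonoid.exists_list_of_mem_closure hx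
  choose ξ α β h using fun j : Fin l.length => hl _ (l.get_mem j)
  refine ⟨l.length, ξ, α, β, ?_⟩
  simp only [← h]
  rw [← List.sum_ofFn, List.ofFn_get]

lemma orderedMonomial_eq_qMonomial (i : Fin k) (z : ℤ) (n : ℕ) :
    orderedMonomial (a i) (b i) z n = qMonomial q a b 0 (Pi.single i z) (Pi.single i n) := by
  rw [qMonomial, zpow_zero, one_smul, ← List.prod_ofFn_ite_eq i (orderedMonomial _ _ z n)]
  congr 2
  funext j
  by_cases h : j = i
  · subst h; simp [orderedMonomial]
  · simp [h]

end monomials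

/-- Mathlib's `Polynomial.Chebyshev.S` and `Polynomial.Chebyshev.C` are the polynomials with
`P (n + 2) = X * P (n + 1) - P n`, `P 1 = X`, and `S 0 = 1`, `C 0 = 2`: the normalized Chebyshev
polynomials of the second kind and of the first kind (usually written `S_n` and `T_n`). -/
theorem mainTheorem4 {𝒜 : Type*} [Ring 𝒜] [Algebra ℂ 𝒜] (q : ℂ) (hq : q ≠ 0) (k : ℕ)
    (a : Fin k → 𝒜ˣ) (b : Fin k → 𝒜) (A : Fin k → Matrix (Fin 2) (Fin 2) 𝒜)
    (hA : ∀ i, A i = !![(a i : 𝒜), b i; 0, ((a i)⁻¹ : 𝒜ˣ)] ∨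
      A i = !![(a i : 𝒜), 0; b i, ((a i)⁻¹ : 𝒜ˣ)])
    (hba : ∀ i, b i * (a i : 𝒜) = q • ((a i : 𝒜) * b i))
    (haa : ∀ i j, i ≠ j → Commute (a i : 𝒜) (a j : 𝒜))
    (hab : ∀ i j, i ≠ j → Commute (a i : 𝒜) (b j))
    (hbb : ∀ i j, i ≠ j → Commute (b i) (b j)) (n : ℕ) :
    IsSumOfPositiveMonomials q a b
        (Polynomial.aeval (List.ofFn A).prod.trace (Polynomial.Chebyshev.S ℤ n)) ∧
      IsSumOfPositiveMonomials q a b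
        (Polynomial.aeval (List.ofFn A).prod.trace (Polynomial.Chebyshev.C ℤ n)) := by
  have hex (i : Fin k) : ∃ R, IsSymPowerFamily q (a i) (b i) (A i) R := by
    obtain h | h := hA i <;> rw [h]
    exacts [⟨_, isSymPowerFamily_upper hq (hba i)⟩, ⟨_, isSymPowerFamily_lower hq (hba i)⟩]
  choose R hR using hex
  have hc (i j : Fin k) (hij : i ≠ j) (c d m s t) : Commute (A i c d) (R j m s t) :=
    (hR i).entry_commute
      ((hR j).commute (haa j i hij.symm) (hab i j hij).symm m s t).symm
      ((hR j).commute (hab j i hij.symm) (hbb j i hij.symm) m s t).symm c d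
  obtain ⟨S, hS⟩ : ∃ S : Subsemiring 𝒜, ∀ x, x ∈ S ↔
      x ∈ AddSubmonoid.closure {x | ∃ ξ α β, x = qMonomial q a b ξ α β} :=
    -- Since the monomials are closed under products, the subsemiring they generate consists of
    -- their finite sums.
    ⟨(qMonomialSubmonoid hq hba haa hab hbb).subsemiringClosure,
      fun _ => Submonoid.subsemiringClosure_mem _⟩
  have hmon (ξ α β) : qMonomial q a b ξ α β ∈ S :=
    (hS _).2 (AddSubmonoid.subset_closure ⟨ξ, α, β, rfl⟩)
  have hord (i z n) : orderedMonomial (a i) (b i) z n ∈ S := by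
    rw [orderedMonomial_eq_qMonomial (q := q)]
    exact hmon _ _ _
  have key := aeval_trace_chebyshev_mem hR hc hq S
    (fun i => by simpa [orderedMonomial] using hord i 1 0)
    (fun i => by simpa [orderedMonomial] using hord i (-1) 0)
    (fun i => by simpa [orderedMonomial] using hord i 0 1)
    (fun z => by simpa [qMonomial, Algebra.algebraMap_eq_smul_one] using hmon z 0 0) n
  exact ⟨isSumOfPositiveMonomials_of_mem_closure ((hS _).1 key.1),
    isSumOfPositiveMonomials_of_mem_closure ((hS _).1 key.2)⟩
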